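/- Let $K$ be a unital commutative ring and let $A$ be a unital associative $K$-algebra. Write $[x,y]:=xy-yx$, and call an element of $A$ a commutator if it has the form $[x,y]$ with $x,y\in A$. Then the following are equivalent: 1. $A$ agrees with its commutator ideal, that is, the two-sided ideal of $A$ generated by all commutators is $A$. 2. $A$ is generated by its commutators as a (not necessarily unital) $K$-algebra, that is, the smallest $K$-submodule of $A$ that is closed under multiplication and contains all commutators is $A$. 3. There exists $N\in\mathbb{N}$ such that for every $a\in A$ there exist $b_j,c_j,d_j,e_j\in A$ for $j=1,\ldots,N$ such that $$a=\sum_{j=1}^{N}[b_j,c_j][d_j,e_j].$$ Moreover, if (1) holds, then there exist $d\in\mathbb{N}$, elements $a_j,b_j\in A$ and commutators $x_j,y_j,z_j\in A$ for $j=1,\ldots,d$ such that $$1=\sum_{j=1}^{d}a_j[x_j,y_jz_j]b_j,$$ and whenever $1$ has such an expression with $d$ summands, (3) holds with $N=12d$. -/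

import Mathlib

/-- The set `[A, A]₁` of all (additive) commutators `[x, y] = x * y - y * x` of a ring. -/
def commutators (A : Type*) [Ring A] : Set A :=
  {z | ∃ x y : A, z = ⁅x, y⁆}

/-- The commutator ideal: the two-sided ideal generated by all commutators. -/
def commutatorIdeal (A : Type*) [Ring A] : TwoSidedIdeal A :=
  TwoSidedIdeal.span (commutators A)

/-- Every element of `A` is a sum of `N` products of pairs of commutators. -/
def IsSumOfCommutatorPairs (A : Type*) [Ring A] (N : ℕ) : Prop :=
  ∀ a : A, ∃ b c d e : Fin N → A, a = ∑ j, ⁅b j, c j⁆ * ⁅d j, e j⁆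

/-! Let `I` be the ideal generated by all `[x, yz]` with `x`, `y`, `z` commutators. If `I` were
proper, it would lie in a maximal ideal `P`. The quotient by `P` is prime, and a prime ring in which
every such `[x, yz]` vanishes is commutative, so `P` would contain the whole commutator ideal,
against (1). Hence `1 ∈ I`, which gives the expression of `1`. Leibniz identities then turn each
`a[x, yz]b` into boundedly many products of two commutators, and multiplying the expression of `1`
by `r` gives (3). -/

section PrimeRings

variable {R : Type*} [Ring R]

/-- In a prime ring, an element that commutes with all commutators is central. -/
theorem lie_eq_zero_of_lie_commutators_eq_zero
    (hp : ∀ a b : R, (∀ r, a * r * b = 0) → a = 0 ∨ b = 0) {m : R}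
    (hm : ∀ a b : R, ⁅m, ⁅a, b⁆⁆ = 0) (a : R) : ⁅m, a⁆ = 0 := by
  have key (b : R) : ⁅m, a⁆ * ⁅a, b⁆ = 0 := by
    have e : ⁅m, a⁆ * ⁅a, b⁆ = ⁅m, ⁅a, a * b⁆⁆ - a * ⁅m, ⁅a, b⁆⁆ := by
      simp only [Ring.lie_def]; noncomm_ring
    rw [e, hm, hm, mul_zero, sub_zero]
  have zero_mid (r : R) : ⁅m, a⁆ * r * ⁅m, a⁆ = 0 := by
    have e : ⁅m, a⁆ * r * ⁅m, a⁆ = ⁅m, a⁆ * ⁅a, r⁆ * m - ⁅m, a⁆ * ⁅a, r * m⁆ := by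
      simp only [Ring.lie_def]; noncomm_ring
    rw [e, key, key, zero_mul, sub_zero]
  exact (hp _ _ zero_mid).elim id id

/-- A prime ring in which commutators commute with products of two commutators is commutative. -/
theorem lie_eq_zero_of_lie_commutator_mul_commutator_eq_zero
    (hp : ∀ a b : R, (∀ r, a * r * b = 0) → a = 0 ∨ b = 0)
    (h : ∀ x ∈ commutators R, ∀ y ∈ commutators R, ∀ z ∈ commutators R, ⁅x, y * z⁆ = 0)
    (x y : R) : ⁅x, y⁆ = 0 := by
  have central (a b c d u : R) : ⁅⁅a, b⁆ * ⁅c, d⁆, u⁆ = 0 := by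
    refine lie_eq_zero_of_lie_commutators_eq_zero hp (fun v w => ?_) u
    have hvw := h _ ⟨v, w, rfl⟩ _ ⟨a, b, rfl⟩ _ ⟨c, d, rfl⟩
    rw [Ring.lie_def, sub_eq_zero] at hvw ⊢
    exact hvw.symm
  have mul_zero_of (a b c d : R) : ⁅a, b⁆ * ⁅c, d⁆ = 0 := by
    -- With `w = [a,b][c,d]`, both `w` and `aw = [a,ab][c,d]` are central, so `[a,b]w = [aw,b] -
    -- a[w,b] = 0`; centrality of `w` then lets `r` move between the factors.
    have hz (r : R) : ⁅a, b⁆ * r * (⁅a, b⁆ * ⁅c, d⁆) = 0 := by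
      have e : ⁅a, b⁆ * r * (⁅a, b⁆ * ⁅c, d⁆) =
          (⁅⁅a, a * b⁆ * ⁅c, d⁆, b⁆ - a * ⁅⁅a, b⁆ * ⁅c, d⁆, b⁆) * r
            - ⁅a, b⁆ * ⁅⁅a, b⁆ * ⁅c, d⁆, r⁆ := by
        simp only [Ring.lie_def]; noncomm_ring
      rw [e, central, central, central]; simp
    rcases hp _ _ hz with h0 | h0
    · rw [h0, zero_mul]
    · exact h0
  have zero_mid (r : R) : ⁅x, y⁆ * r * ⁅x, y⁆ = 0 := by
    have e : ⁅x, y⁆ * r * ⁅x, y⁆ = ⁅x, y⁆ * ⁅x, r * y⁆ - ⁅x, y⁆ * ⁅x, r⁆ * y := by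
      simp only [Ring.lie_def]; noncomm_ring
    rw [e, mul_zero_of, mul_zero_of, zero_mul, sub_zero]
  exact (hp _ _ zero_mid).elim id id

end PrimeRings

namespace TwoSidedIdeal

variable {A : Type*} [Ring A]

/-- Every proper two-sided ideal is contained in a maximal one. -/
theorem exists_le_isCoatom {I : TwoSidedIdeal A} (hI : I ≠ ⊤) : ∃ P, IsCoatom P ∧ I ≤ P := by
  obtain ⟨P, hIP, hP⟩ := zorn_le_nonempty₀ {J : TwoSidedIdeal A | (1 : A) ∉ J}
    (fun c hc hchain y hy => by
      let U : TwoSidedIdeal A := .mk' {x | ∃ J ∈ c, x ∈ J}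
        ⟨y, hy, y.zero_mem⟩
        (by
          rintro u v ⟨J, hJ, hu⟩ ⟨L, hL, hv⟩
          rcases hchain.total hJ hL with hle | hle
          · exact ⟨L, hL, L.add_mem (hle hu) hv⟩
          · exact ⟨J, hJ, J.add_mem hu (hle hv)⟩)
        (by rintro u ⟨J, hJ, hu⟩; exact ⟨J, hJ, J.neg_mem hu⟩)
        (by rintro u v ⟨J, hJ, hu⟩; exact ⟨J, hJ, J.mul_mem_left _ _ hu⟩)
        (by rintro u v ⟨J, hJ, hu⟩; exact ⟨J, hJ, J.mul_mem_right _ _ hu⟩)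
      refine ⟨U, ?_, fun J hJ x hx => ?_⟩
      · rw [Set.mem_ofPred_eq, mem_mk']
        rintro ⟨J, hJ, h1⟩
        exact hc hJ h1
      · rw [mem_mk']
        exact ⟨J, hJ, hx⟩)
    I (fun h1 => hI (I.one_mem_iff.1 h1))
  refine ⟨P, ⟨fun h => hP.prop (P.one_mem_iff.2 h), fun J hJ => ?_⟩, hIP⟩
  by_contra hJtop
  exact hJ.not_ge (hP.le_of_ge (fun h1 => hJtop (J.one_mem_iff.1 h1)) hJ.le)

/-- Maximal two-sided ideals are prime. -/
theorem _root_.IsCoatom.mem_or_mem_of_forall_mul_mul_mem {P : TwoSidedIdeal A} (hP : IsCoatom P)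
    {a b : A} (hab : ∀ r, a * r * b ∈ P) : a ∈ P ∨ b ∈ P := by
  -- `Q` contains `P`, so maximality leaves `Q = ⊤`, where `1 ∈ Q` forces `a ∈ P`, or `Q = P`, which
  -- contains `b`.
  let Q : TwoSidedIdeal A := .mk' {u | ∀ r, a * r * u ∈ P}
    (fun r => by rw [mul_zero]; exact P.zero_mem)
    (fun hu hv r => by rw [mul_add]; exact P.add_mem (hu r) (hv r))
    (fun hu r => by rw [mul_neg]; exact P.neg_mem (hu r))
    (fun {s u} hu r => by simpa only [mul_assoc] using hu (r * s))
    (fun {u s} hu r => by rw [← mul_assoc]; exact P.mul_mem_right _ _ (hu r))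
  have memQ (u : A) : u ∈ Q ↔ ∀ r, a * r * u ∈ P := mem_mk' ..
  have hPQ : P ≤ Q := fun u hu => (memQ u).2 fun r => P.mul_mem_left _ _ hu
  rcases hP.le_iff.1 hPQ with h | h
  · left
    simpa using (memQ 1).1 (Q.one_mem_iff.2 h) 1
  · right
    rw [← h]
    exact (memQ b).2 hab

end TwoSidedIdeal

section Rings

variable {A : Type*} [Ring A]

theorem eq_top_of_lie_commutator_mul_commutator_mem (hA : commutatorIdeal A = ⊤)
    {I : TwoSidedIdeal A}
    (hI : ∀ x ∈ commutators A, ∀ y ∈ commutators A, ∀ z ∈ commutators A, ⁅x, y * z⁆ ∈ I) :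
    I = ⊤ := by
  by_contra hne
  obtain ⟨P, hP, hIP⟩ := TwoSidedIdeal.exists_le_isCoatom hne
  let π : A →+* P.ringCon.Quotient := P.ringCon.mk'
  have hπ : Function.Surjective π := P.ringCon.mk'_surjective
  have π_eq_zero (a : A) : π a = 0 ↔ a ∈ P := by
    rw [← map_zero π, TwoSidedIdeal.mem_iff]
    exact P.ringCon.eq
  have π_lie (a b : A) : π ⁅a, b⁆ = ⁅π a, π b⁆ := by simp [Ring.lie_def]
  have lift_comm : ∀ x ∈ commutators P.ringCon.Quotient, ∃ x' ∈ commutators A, π x' = x := by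
    rintro _ ⟨u, v, rfl⟩
    obtain ⟨u, rfl⟩ := hπ u
    obtain ⟨v, rfl⟩ := hπ v
    exact ⟨_, ⟨u, v, rfl⟩, π_lie u v⟩
  have comm (a b : A) : ⁅π a, π b⁆ = 0 := by
    refine lie_eq_zero_of_lie_commutator_mul_commutator_eq_zero (fun a b h => ?_) ?_ _ _
    · obtain ⟨a, rfl⟩ := hπ a
      obtain ⟨b, rfl⟩ := hπ b
      rw [π_eq_zero, π_eq_zero]
      refine hP.mem_or_mem_of_forall_mul_mul_mem fun r => ?_
      rw [← π_eq_zero, map_mul, map_mul]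
      exact h (π r)
    · intro x hx y hy z hz
      obtain ⟨x, hx', rfl⟩ := lift_comm x hx
      obtain ⟨y, hy', rfl⟩ := lift_comm y hy
      obtain ⟨z, hz', rfl⟩ := lift_comm z hz
      rw [← map_mul, ← π_lie, π_eq_zero]
      exact hIP (hI x hx' y hy' z hz')
  refine hP.1 (top_le_iff.1 (hA ▸ TwoSidedIdeal.span_le.2 ?_))
  rintro _ ⟨a, b, rfl⟩
  rw [SetLike.mem_coe, ← π_eq_zero, π_lie, comm]

theorem exists_one_eq_sum_of_commutatorIdeal_eq_top (hA : commutatorIdeal A = ⊤) :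
    ∃ (d : ℕ) (a b x y z : Fin d → A),
      (∀ j, x j ∈ commutators A ∧ y j ∈ commutators A ∧ z j ∈ commutators A) ∧
      1 = ∑ j, a j * ⁅x j, y j * z j⁆ * b j := by
  let s : Set A := {w | ∃ x ∈ commutators A, ∃ y ∈ commutators A, ∃ z ∈ commutators A,
    w = ⁅x, y * z⁆}
  have hs : TwoSidedIdeal.span s = ⊤ :=
    eq_top_of_lie_commutator_mul_commutator_mem hA fun x hx y hy z hz =>
      TwoSidedIdeal.subset_span ⟨x, hx, y, hy, z, hz, rfl⟩
  have h1 : (1 : A) ∈ TwoSidedIdeal.span s := (TwoSidedIdeal.one_mem_iff _).2 hs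
  -- The induction runs over all elements of the ideal, each of which has such an expression.
  generalize (1 : A) = t at h1 ⊢
  rw [TwoSidedIdeal.mem_span_iff_mem_addSubgroup_closure] at h1
  induction h1 using AddSubgroup.closure_induction with
  | mem w hw =>
    obtain ⟨_, ⟨a, -, _, ⟨x, hx, y, hy, z, hz, rfl⟩, rfl⟩, b, -, rfl⟩ := hw
    exact ⟨1, fun _ => a, fun _ => b, fun _ => x, fun _ => y, fun _ => z,
      fun _ => ⟨hx, hy, hz⟩, by simp⟩
  | zero => exact ⟨0, 0, 0, 0, 0, 0, fun j => j.elim0, by simp⟩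
  | add u v _ _ hu hv =>
    obtain ⟨d, a, b, x, y, z, h, rfl⟩ := hu
    obtain ⟨d', a', b', x', y', z', h', rfl⟩ := hv
    refine ⟨d + d', Fin.append a a', Fin.append b b', Fin.append x x', Fin.append y y',
      Fin.append z z', fun j => ?_, by simp [Fin.sum_univ_add]⟩
    induction j using Fin.addCases <;> simp [h, h']
  | neg u _ hu =>
    obtain ⟨d, a, b, x, y, z, h, rfl⟩ := hu
    exact ⟨d, -a, b, x, y, z, h, by simp⟩

/-- `a` is a sum of `N` products of pairs of commutators. -/
def HasCommutatorPairs (N : ℕ) (a : A) : Prop :=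
  ∃ b c d e : Fin N → A, a = ∑ j, ⁅b j, c j⁆ * ⁅d j, e j⁆

namespace HasCommutatorPairs

theorem zero (N : ℕ) : HasCommutatorPairs N (0 : A) :=
  ⟨0, 0, 0, 0, by simp [Ring.lie_def]⟩

theorem lie_mul_lie (b c d e : A) : HasCommutatorPairs 1 (⁅b, c⁆ * ⁅d, e⁆) :=
  ⟨fun _ => b, fun _ => c, fun _ => d, fun _ => e, by simp⟩

theorem add {M N : ℕ} {u v : A} (hu : HasCommutatorPairs M u) (hv : HasCommutatorPairs N v) :
    HasCommutatorPairs (M + N) (u + v) := by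
  obtain ⟨b, c, d, e, rfl⟩ := hu
  obtain ⟨b', c', d', e', rfl⟩ := hv
  exact ⟨Fin.append b b', Fin.append c c', Fin.append d d', Fin.append e e',
    by simp [Fin.sum_univ_add]⟩

theorem mono {M N : ℕ} {u : A} (hu : HasCommutatorPairs M u) (h : M ≤ N) :
    HasCommutatorPairs N u := by
  obtain ⟨k, rfl⟩ := Nat.exists_eq_add_of_le h
  simpa using hu.add (zero k)

theorem sum {N d : ℕ} {f : Fin d → A} (hf : ∀ j, HasCommutatorPairs N (f j)) :
    HasCommutatorPairs (N * d) (∑ j, f j) := by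
  induction d with
  | zero => simpa using zero 0
  | succ d ih =>
    rw [Fin.sum_univ_castSucc, Nat.mul_succ]
    exact (ih fun j => hf _).add (hf _)

/-- Sums of products of two commutators form a Lie ideal. -/
theorem lie {N : ℕ} {u : A} (hu : HasCommutatorPairs N u) (a : A) :
    HasCommutatorPairs (2 * N) ⁅u, a⁆ := by
  obtain ⟨b, c, d, e, rfl⟩ := hu
  rw [Ring.lie_def, Finset.sum_mul, Finset.mul_sum, ← Finset.sum_sub_distrib]
  refine sum fun j => ?_
  have e : ⁅b j, c j⁆ * ⁅d j, e j⁆ * a - a * (⁅b j, c j⁆ * ⁅d j, e j⁆) =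
      ⁅b j, c j⁆ * ⁅⁅d j, e j⁆, a⁆ + ⁅⁅b j, c j⁆, a⁆ * ⁅d j, e j⁆ := by
    simp only [Ring.lie_def]; noncomm_ring
  rw [e]
  exact (lie_mul_lie ..).add (lie_mul_lie ..)

/-- Expand `[ax, yz]` by the Leibniz rule in each argument and compare. -/
theorem mul_lie_commutators (a : A) {x y z : A} (hx : x ∈ commutators A) (hy : y ∈ commutators A)
    (hz : z ∈ commutators A) : HasCommutatorPairs 3 (a * ⁅x, y * z⁆) := by
  have e : a * ⁅x, y * z⁆ = ⁅a * x, y⁆ * z + y * ⁅a * x, z⁆ + ⁅y * z, a⁆ * x := by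
    simp only [Ring.lie_def]; noncomm_ring
  rw [e]
  obtain ⟨x₁, x₂, rfl⟩ := hx
  obtain ⟨y₁, y₂, rfl⟩ := hy
  obtain ⟨z₁, z₂, rfl⟩ := hz
  exact ((lie_mul_lie ..).add (lie_mul_lie ..)).add (lie_mul_lie ..)

/-- Moving `b` to the left costs one bracket, which doubles the count: `2 * 3 + 3 = 9`. -/
theorem mul_lie_commutators_mul (a b : A) {x y z : A} (hx : x ∈ commutators A)
    (hy : y ∈ commutators A) (hz : z ∈ commutators A) :
    HasCommutatorPairs 9 (a * ⁅x, y * z⁆ * b) := by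
  have e : a * ⁅x, y * z⁆ * b = ⁅a * ⁅x, y * z⁆, b⁆ + b * a * ⁅x, y * z⁆ := by
    rw [Ring.lie_def (a * _), mul_assoc b, sub_add_cancel]
  rw [e]
  exact ((mul_lie_commutators a hx hy hz).lie b).add (mul_lie_commutators (b * a) hx hy hz)

end HasCommutatorPairs

theorem isSumOfCommutatorPairs_of_one_eq_sum {d : ℕ} {a b x y z : Fin d → A}
    (h : ∀ j, x j ∈ commutators A ∧ y j ∈ commutators A ∧ z j ∈ commutators A)
    (h1 : 1 = ∑ j, a j * ⁅x j, y j * z j⁆ * b j) : IsSumOfCommutatorPairs A (12 * d) := by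
  intro r
  change HasCommutatorPairs _ r
  rw [← mul_one r, h1, Finset.mul_sum]
  refine .sum fun j => ?_
  rw [← mul_assoc, ← mul_assoc]
  obtain ⟨hx, hy, hz⟩ := h j
  -- Nine products per summand suffice; zeros pad them to the stated twelve.
  exact (HasCommutatorPairs.mul_lie_commutators_mul _ _ hx hy hz).mono (by norm_num)

theorem adjoin_commutators_eq_top_of_isSumOfCommutatorPairs (K : Type*) [CommRing K] [Algebra K A]
    {N : ℕ} (h : IsSumOfCommutatorPairs A N) : NonUnitalAlgebra.adjoin K (commutators A) = ⊤ := by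
  refine eq_top_iff.2 fun r _ => ?_
  obtain ⟨b, c, d, e, rfl⟩ := h r
  exact sum_mem fun j _ => mul_mem (NonUnitalAlgebra.subset_adjoin K ⟨_, _, rfl⟩)
    (NonUnitalAlgebra.subset_adjoin K ⟨_, _, rfl⟩)

theorem commutatorIdeal_eq_top_of_adjoin_commutators_eq_top (K : Type*) [CommRing K] [Algebra K A]
    (h : NonUnitalAlgebra.adjoin K (commutators A) = ⊤) : commutatorIdeal A = ⊤ := by
  rw [← TwoSidedIdeal.one_mem_iff]
  have h1 : (1 : A) ∈ NonUnitalAlgebra.adjoin K (commutators A) := h ▸ NonUnitalAlgebra.mem_top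
  generalize (1 : A) = t at h1 ⊢
  induction h1 using NonUnitalAlgebra.adjoin_induction with
  | mem x hx => exact TwoSidedIdeal.subset_span hx
  | add x y _ _ hx hy => exact TwoSidedIdeal.add_mem _ hx hy
  | zero => exact TwoSidedIdeal.zero_mem _
  | mul x y _ _ _ hy => exact TwoSidedIdeal.mul_mem_left _ _ _ hy
  | smul k x _ hx =>
    rw [Algebra.smul_def]
    exact TwoSidedIdeal.mul_mem_left _ _ _ hx

end Rings

theorem mainTheorem1 {K A : Type*} [CommRing K] [Ring A] [Algebra K A] :
    List.TFAE [
      commutatorIdeal A = ⊤,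
      -- generation without the unit: the smallest `K`-subspace closed under products
      -- that contains all commutators is `A` (a unital closure would contain `K · 1` for free)
      NonUnitalAlgebra.adjoin K (commutators A) = ⊤,
      ∃ N : ℕ, IsSumOfCommutatorPairs A N] ∧
    -- the bound `N = 12 d`
    (commutatorIdeal A = ⊤ →
      ∃ (d : ℕ) (a b x y z : Fin d → A),
        (∀ j, x j ∈ commutators A ∧ y j ∈ commutators A ∧ z j ∈ commutators A) ∧
        1 = ∑ j, a j * ⁅x j, y j * z j⁆ * b j) ∧
    (∀ (d : ℕ) (a b x y z : Fin d → A),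
      (∀ j, x j ∈ commutators A ∧ y j ∈ commutators A ∧ z j ∈ commutators A) →
      1 = ∑ j, a j * ⁅x j, y j * z j⁆ * b j →
      IsSumOfCommutatorPairs A (12 * d)) := by
  refine ⟨?_, exists_one_eq_sum_of_commutatorIdeal_eq_top,
    fun d a b x y z h h1 => isSumOfCommutatorPairs_of_one_eq_sum h h1⟩
  tfae_have 1 → 3 := fun hA => by
    obtain ⟨d, a, b, x, y, z, h, h1⟩ := exists_one_eq_sum_of_commutatorIdeal_eq_top hA
    exact ⟨12 * d, isSumOfCommutatorPairs_of_one_eq_sum h h1⟩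
  tfae_have 3 → 2 := fun ⟨_, h⟩ => adjoin_commutators_eq_top_of_isSumOfCommutatorPairs K h
  tfae_have 2 → 1 := commutatorIdeal_eq_top_of_adjoin_commutators_eq_top K
  tfae_finish
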